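/- A basis means a Schauder basis, and Banach spaces are real. Two sequences $\{x_i\}_{i\ge 0}$, $\{y_i\}_{i\ge 0}$ (in possibly different normed spaces) are equivalent if there is $K>0$ such that $\|\sum a_i x_i\|\le K\|\sum a_i y_i\|$ and $\|\sum a_i y_i\|\le K\|\sum a_i x_i\|$ for all finitely supported real sequences $(a_i)$. A block basis of $\{e_i\}$ is a sequence of nonzero vectors $x_n=\sum_{p_n\le j<p_{n+1}}a_je_j$ with $p_0<p_1<\dots$. A Rosenthal basis is a normalized basis $\{e_i\}$ such that every normalized block basis of $\{e_i\}$ has a subsequence equivalent to $\{e_i\}$. A sequence $\{\tilde x_i\}_{i\ge0}$ in a normed space is a spreading model in a Banach space $X$ if there is a basic sequence $\{x_i\}$ in $X$ with $0<c<\|x_i\|<C$ for all $i$ and some constants $c,C$, such that for all $k\geq 0$ and $r_0,\dots,r_k\in\mathbb R$, $$\|r_0\tilde x_0+\dots+r_k\tilde x_k\|=\lim_{l_0<\dots<l_k,\ l_0\to\infty}\|r_0x_{l_0}+\dots+r_kx_{l_k}\|.$$ Let $\{e_i\}$ be a Rosenthal basis of a Banach space $X$. Then $\{e_i\}$ is equivalent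 to the unit vector basis of $c_0$, or $\{e_i\}$ is equivalent to the unit vector basis of $\ell_1$, or $X$ is reflexive. If $X$ is reflexive, then every spreading model in $X$ is equivalent to $\{e_i\}$. -/

import Mathlib

open Filter Topology
open scoped ZeroAtInfty ENNReal

namespace RosenthalBasis

/-- Two sequences (in possibly different real normed spaces) are equivalent if each of them
dominates the other, with some constant, on all finitely supported sequences of scalars. -/
def Equivalent {E F : Type*} [NormedAddCommGroup E] [NormedSpace ℝ E]
    [NormedAddCommGroup F] [NormedSpace ℝ F] (x : ℕ → E) (y : ℕ → F) : Prop :=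
  ∃ K : ℝ, 0 < K ∧ ∀ a : ℕ →₀ ℝ,
    ‖∑ i ∈ a.support, a i • x i‖ ≤ K * ‖∑ i ∈ a.support, a i • y i‖ ∧
    ‖∑ i ∈ a.support, a i • y i‖ ≤ K * ‖∑ i ∈ a.support, a i • x i‖

/-- The space `c₀` of real sequences converging to `0`, with the supremum norm, is `C₀(ℕ, ℝ)`;
this is its unit vector basis. -/
noncomputable def c0UnitVector (n : ℕ) : C₀(ℕ, ℝ) where
  toFun := Pi.single n 1
  continuous_toFun := continuous_of_discreteTopology
  zero_at_infty' := by
    rw [cocompact_eq_cofinite, Nat.cofinite_eq_atTop]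
    refine tendsto_const_nhds.congr' ?_
    filter_upwards [eventually_gt_atTop n] with m hm
    simp [hm.ne']

/-- The unit vector basis of `ℓ₁`. -/
noncomputable def l1UnitVector (n : ℕ) : lp (fun _ : ℕ => ℝ) 1 :=
  lp.single 1 n (1 : ℝ)

/-- `x` is a normalized block basis of `e`: there are `p 0 < p 1 < ...` and scalars `a j` with
`x n = ∑_{p n ≤ j < p (n + 1)} a j • e j` and `‖x n‖ = 1`. (Coefficients may vanish, so gaps
between the supports are allowed.) -/
def IsNormalizedBlockBasis {X : Type*} [NormedAddCommGroup X] [NormedSpace ℝ X]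
    (e x : ℕ → X) : Prop :=
  (∃ (p : ℕ → ℕ) (a : ℕ → ℝ), StrictMono p ∧
    ∀ n, x n = ∑ j ∈ Finset.Ico (p n) (p (n + 1)), a j • e j) ∧
  ∀ n, ‖x n‖ = 1

/-- A Rosenthal basis: a normalized Schauder basis such that every normalized block basis has a
subsequence equivalent to the basis. -/
def IsRosenthal {X : Type*} [NormedAddCommGroup X] [NormedSpace ℝ X]
    (e : SchauderBasis ℝ X) : Prop :=
  (∀ i, ‖e i‖ = 1) ∧
  ∀ x : ℕ → X, IsNormalizedBlockBasis e x →
    ∃ φ : ℕ → ℕ, StrictMono φ ∧ Equivalent (x ∘ φ) e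

/-- A normed space is reflexive if the canonical map into its bidual is onto. -/
def IsReflexive (X : Type*) [NormedAddCommGroup X] [NormedSpace ℝ X] : Prop :=
  Function.Surjective (NormedSpace.inclusionInDoubleDual ℝ X)

/-- A basic sequence: a sequence that is a Schauder basis of its closed linear span. -/
def IsBasicSequence {X : Type*} [NormedAddCommGroup X] [NormedSpace ℝ X] (x : ℕ → X) : Prop :=
  ∃ b : SchauderBasis ℝ (Submodule.span ℝ (Set.range x)).topologicalClosure,
    ∀ i, (b i : X) = x i

/-- A sequence whose norms are bounded, and bounded away from `0`. -/
def IsSeminormalized {X : Type*} [NormedAddCommGroup X] (x : ℕ → X) : Prop :=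
  ∃ c C : ℝ, 0 < c ∧ c < C ∧ ∀ i, c < ‖x i‖ ∧ ‖x i‖ < C

/-- The seminormalized basic sequence `x` generates the spreading model `y`:
`‖r₀ y₀ + ⋯ + r_k y_k‖` is the limit of `‖r₀ x_{l₀} + ⋯ + r_k x_{l_k}‖` over
`l₀ < ⋯ < l_k`, `l₀ → ∞`. A spreading model is determined by these norms up to linear isometry,
so `y` may live in any normed space `Y`. -/
def GeneratesSpreadingModel {X Y : Type*} [NormedAddCommGroup X] [NormedSpace ℝ X]
    [NormedAddCommGroup Y] [NormedSpace ℝ Y] (x : ℕ → X) (y : ℕ → Y) : Prop :=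
  IsSeminormalized x ∧ IsBasicSequence x ∧
  ∀ (k : ℕ) (r : Fin (k + 1) → ℝ), ∀ ε > 0, ∃ N : ℕ, ∀ l : Fin (k + 1) → ℕ,
    StrictMono l → N < l 0 →
      |‖∑ i, r i • x (l i)‖ - ‖∑ i, r i • y (i : ℕ)‖| < ε

end RosenthalBasis

/-!
A Rosenthal basis `e` is subsymmetric and unconditional, and both parts of the theorem follow by
passing to block bases.

*Subsymmetry.* If `e` were not uniformly equivalent to its subsequences, there would be, for each
`n`, coefficients `a n` and two subsequences of `e` beyond `n` for which the norms of the linear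
combinations with coefficients `a n` have ratio greater than `n`. By Ramsey's theorem and a diagonal
argument, along some `M` the norm of `∑ a n i • e (t i)` is, up to the factor `2`, independent of
the increasing sequence `t` in `M`, as long as `t` starts far enough out. But a subsequence of
`e ∘ M` is equivalent to `e`, which bounds the ratios
(`IsRosenthal.exists_dominated_tail`, `IsRosenthal.exists_isSubsymmetric`).

*Unconditionality.* The differences `e (2 i) - e (2 i + 1)` of a subsymmetric sequence are
unconditional, by an averaging argument of Brunel and Sucheston
(`IsSubsymmetric.isUnconditional_sub`). Normalized, they form a block basis, so that a subsequence of
them is equivalent to `e` (`IsRosenthal.exists_isUnconditional`).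

*The trichotomy.* This is James' analysis of unconditional bases. If `e` is not shrinking, some
normalized block basis has a lower `ℓ₁`-estimate; if `e` is not boundedly complete, some normalized
block basis has an upper `c₀`-estimate. A subsequence of that block basis is equivalent to `e`, so
`e` is equivalent to the unit vector basis of `ℓ₁`, respectively `c₀`. If `e` is shrinking and
boundedly complete, the space is reflexive
(`isReflexive_of_isShrinking_of_isBoundedlyComplete`).

*Spreading models.* In a reflexive space a bounded basic sequence `x` is weakly null, so if it
generates a spreading model `y`, a gliding hump gives a subsequence asymptotic to `‖y 0‖` times a
normalized block basis of `e` (`exists_isNormalizedBlockBasis_tendsto`). The block basis has a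
subsequence equivalent to `e`, and subsymmetry of `e` carries the equivalence to the limit
(`IsRosenthal.equivalent_spreadingModel`).
-/

namespace RosenthalBasis

/-! ### Infinite Ramsey theory -/

/-- Diagonalization over subsequences: countably many properties, each inherited by subsequences
and attainable below every sequence, can be achieved by the tails of a single sequence. -/
theorem exists_strictMono_diagonal (P : ℕ → (ℕ → ℕ) → Prop)
    (hsub : ∀ n M (θ : ℕ → ℕ), StrictMono θ → P n M → P n (M ∘ θ))
    (hex : ∀ n M, StrictMono M → ∃ θ : ℕ → ℕ, StrictMono θ ∧ P n (M ∘ θ)) :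
    ∃ M : ℕ → ℕ, StrictMono M ∧ ∀ n, P n (fun i => M (n + i)) := by
  choose θ hθ hP using fun (n : ℕ) (M : {M : ℕ → ℕ // StrictMono M}) => hex n M.1 M.2
  let seq : ℕ → {M : ℕ → ℕ // StrictMono M} := fun n =>
    Nat.rec ⟨id, strictMono_id⟩ (fun n M => ⟨M.1 ∘ θ n M, M.2.comp (hθ n M)⟩) n
  have hseq (n) : (seq (n + 1)).1 = (seq n).1 ∘ θ n (seq n) := rfl
  have hmono : StrictMono fun n => (seq (n + 1)).1 n := by
    refine strictMono_nat_of_lt_succ fun n => ?_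
    rw [hseq (n + 1)]
    exact (seq (n + 1)).2 (n.lt_succ_self.trans_le ((hθ _ _).id_le (n + 1)))
  have hrange (n m : ℕ) : Set.range (seq (n + m)).1 ⊆ Set.range (seq n).1 := by
    induction m with
    | zero => exact subset_rfl
    | succ m ih =>
      rw [← add_assoc, hseq]
      exact (Set.range_comp_subset_range _ _).trans ih
  refine ⟨_, hmono, fun n => ?_⟩
  have hmem (i : ℕ) : ∃ j, (seq (n + 1)).1 j = (seq (n + i + 1)).1 (n + i) := by
    rw [show n + i + 1 = n + 1 + i by ring]
    exact hrange (n + 1) i ⟨_, rfl⟩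
  choose u hu using hmem
  have hu' : StrictMono u := fun i j hij => by
    rw [← (seq (n + 1)).2.lt_iff_lt, hu, hu]
    exact hmono (by omega)
  have := hsub n _ u hu' (hP n (seq n))
  rw [← hseq] at this
  convert this using 1
  funext i
  exact (hu i).symm

/-- The infinite Ramsey theorem for `k`-element subsets of `ℕ`. A colouring of the `k`-element
subsets is encoded as a colouring of sequences that depends on the first `k` terms only. -/
theorem exists_strictMono_homogeneous {κ : Type*} [Finite κ] (k : ℕ) (c : (ℕ → ℕ) → κ)
    (hc : ∀ t t' : ℕ → ℕ, (∀ i < k, t i = t' i) → c t = c t') :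
    ∃ M : ℕ → ℕ, StrictMono M ∧ ∀ t t' : ℕ → ℕ, StrictMono t → StrictMono t' →
      c (M ∘ t) = c (M ∘ t') := by
  induction k generalizing c with
  | zero => exact ⟨id, strictMono_id, fun t t' _ _ => hc _ _ (by simp)⟩
  | succ k ih =>
    let cons : ℕ → (ℕ → ℕ) → ℕ → ℕ := fun l t i => Nat.casesOn i l t
    obtain ⟨M, hM, hhom⟩ := exists_strictMono_diagonal
      (fun l M => ∀ t t' : ℕ → ℕ, StrictMono t → StrictMono t' →
        c (cons l (M ∘ t)) = c (cons l (M ∘ t')))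
      (fun l M θ hθ h t t' ht ht' => h (θ ∘ t) (θ ∘ t') (hθ.comp ht) (hθ.comp ht'))
      (fun l M hM => ih (fun t => c (cons l (M ∘ t))) fun t t' htt' => hc _ _ fun i hi => by
        cases i with
        | zero => rfl
        | succ i => exact congrArg M (htt' i (by omega)))
    -- Thin out `M` so that the terms after any term `l` lie in the tail of `M` from index `l` on,
    -- where the colour of a tuple starting with `l` no longer depends on its other entries.
    let θ : ℕ → ℕ := fun n => Nat.rec 0 (fun _ m => M m + 1) n
    have hθs (n) : θ (n + 1) = M (θ n) + 1 := rfl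
    have hθ : StrictMono θ := strictMono_nat_of_lt_succ fun n => by
      rw [hθs]
      exact Nat.lt_succ_of_le (hM.id_le _)
    let d : ℕ → κ := fun l => c (cons l fun i => M (l + i))
    have hd (t) (ht : StrictMono t) : c (M ∘ θ ∘ t) = d (M (θ (t 0))) := by
      set l := M (θ (t 0)) with hl
      have hle (i : ℕ) : l < θ (t (i + 1)) := by
        have : θ (t 0 + 1) ≤ θ (t (i + 1)) := hθ.monotone (ht (Nat.succ_pos i))
        rw [hθs] at this
        omega
      have hu : StrictMono fun i => θ (t (i + 1)) - l := fun i j hij => by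
        have h1 := hle i
        have h2 : θ (t (i + 1)) < θ (t (j + 1)) := hθ (ht (by omega))
        show θ (t (i + 1)) - l < θ (t (j + 1)) - l
        omega
      have := hhom l _ _ hu strictMono_id
      refine Eq.trans (congrArg c ?_) this
      funext i
      cases i with
      | zero => rfl
      | succ i =>
        show M (θ (t (i + 1))) = M (l + (θ (t (i + 1)) - l))
        rw [Nat.add_sub_cancel' (hle i).le]
    obtain ⟨q, hq⟩ : ∃ q, ∃ᶠ n in atTop, d (M (θ n)) = q := by
      by_contra! h
      have h' : ∀ᶠ n in atTop, ∀ q, d (M (θ n)) ≠ q :=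
        eventually_all.2 h
      obtain ⟨n, hn⟩ := h'.exists
      exact hn _ rfl
    obtain ⟨ψ, hψ, hψq⟩ := extraction_of_frequently_atTop hq
    have key (t) (ht : StrictMono t) : c ((M ∘ θ ∘ ψ) ∘ t) = q :=
      (hd (ψ ∘ t) (hψ.comp ht)).trans (hψq _)
    exact ⟨M ∘ θ ∘ ψ, hM.comp (hθ.comp hψ), fun t t' ht ht' => (key t ht).trans (key t' ht').symm⟩

/-- A bounded function of increasing `k`-tuples has arbitrarily small oscillation on some infinite
subset of `ℕ`. -/
theorem exists_strictMono_oscillation_le (k : ℕ) (g : (ℕ → ℕ) → ℝ) (B δ : ℝ) (hδ : 0 < δ)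
    (hg : ∀ t t' : ℕ → ℕ, (∀ i < k, t i = t' i) → g t = g t')
    (h0 : ∀ t, 0 ≤ g t) (hB : ∀ t, g t ≤ B) :
    ∃ M : ℕ → ℕ, StrictMono M ∧
      ∀ t t' : ℕ → ℕ, StrictMono t → StrictMono t' → g (M ∘ t) ≤ g (M ∘ t') + δ := by
  obtain ⟨M, hM, h⟩ := exists_strictMono_homogeneous (κ := Fin (⌊B / δ⌋₊ + 1)) k
    (fun t => ⟨⌊g t / δ⌋₊, Nat.lt_succ_of_le (Nat.floor_mono (by gcongr; exact hB t))⟩)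
    (fun t t' htt' => by simp [hg t t' htt'])
  refine ⟨M, hM, fun t t' ht ht' => ?_⟩
  have h1 : ⌊g (M ∘ t) / δ⌋₊ = ⌊g (M ∘ t') / δ⌋₊ := by simpa using h t t' ht ht'
  have h2 := Nat.lt_floor_add_one (g (M ∘ t) / δ)
  have h3 := Nat.floor_le (div_nonneg (h0 (M ∘ t')) hδ.le)
  rw [h1] at h2
  have h4 : g (M ∘ t) / δ < g (M ∘ t') / δ + 1 := by linarith
  rw [div_lt_iff₀ hδ, add_mul, div_mul_cancel₀ _ hδ.ne', one_mul] at h4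
  exact h4.le

/-! ### Domination of sequences and subsymmetry -/

section Domination

variable {E F G : Type*} [NormedAddCommGroup E] [NormedSpace ℝ E] [NormedAddCommGroup F]
  [NormedSpace ℝ F] [NormedAddCommGroup G] [NormedSpace ℝ G]

/-- `x` is `K`-dominated by `y`: linear combinations of `x` are at most `K` times as large as those
of `y` with the same coefficients. -/
def Dominated (K : ℝ) (x : ℕ → E) (y : ℕ → F) : Prop :=
  ∀ (s : Finset ℕ) (a : ℕ → ℝ), ‖∑ i ∈ s, a i • x i‖ ≤ K * ‖∑ i ∈ s, a i • y i‖

theorem Dominated.trans {K L : ℝ} {x : ℕ → E} {y : ℕ → F} {z : ℕ → G} (hK : 0 ≤ K)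
    (h : Dominated K x y) (h' : Dominated L y z) : Dominated (K * L) x z := fun s a => by
  rw [mul_assoc]
  exact (h s a).trans (mul_le_mul_of_nonneg_left (h' s a) hK)

theorem Dominated.mono {K L : ℝ} {x : ℕ → E} {y : ℕ → F} (hKL : K ≤ L)
    (h : Dominated K x y) : Dominated L x y := fun s a =>
  (h s a).trans (mul_le_mul_of_nonneg_right hKL (norm_nonneg _))

theorem sum_comp_eq_sum_image (x : ℕ → E) {φ : ℕ → ℕ} (hφ : Function.Injective φ)
    (s : Finset ℕ) (a : ℕ → ℝ) :
    ∑ i ∈ s, a i • x (φ i) = ∑ j ∈ s.image φ, a (Function.invFun φ j) • x j := by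
  rw [Finset.sum_image fun _ _ _ _ h => hφ h]
  simp [Function.leftInverse_invFun hφ _]

theorem Dominated.comp {K : ℝ} {x : ℕ → E} {y : ℕ → F} (h : Dominated K x y) {φ : ℕ → ℕ}
    (hφ : Function.Injective φ) : Dominated K (x ∘ φ) (y ∘ φ) := fun s a => by
  simpa only [Function.comp_apply, sum_comp_eq_sum_image _ hφ] using
    h (s.image φ) fun j => a (Function.invFun φ j)

theorem equivalent_iff_dominated {x : ℕ → E} {y : ℕ → F} :
    Equivalent x y ↔ ∃ K : ℝ, 0 < K ∧ Dominated K x y ∧ Dominated K y x := by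
  classical
  constructor
  · rintro ⟨K, hK, h⟩
    have key (s : Finset ℕ) (a : ℕ → ℝ) : ∃ b : ℕ →₀ ℝ,
        ∑ i ∈ b.support, b i • x i = ∑ i ∈ s, a i • x i ∧
        ∑ i ∈ b.support, b i • y i = ∑ i ∈ s, a i • y i := by
      refine ⟨Finsupp.onFinset s (fun i => if i ∈ s then a i else 0) (by simp; tauto), ?_, ?_⟩ <;>
      · rw [Finset.sum_subset Finsupp.support_onFinset_subset
          (by intro i _ hi; rw [Finsupp.notMem_support_iff.1 hi, zero_smul])]
        exact Finset.sum_congr rfl fun i hi => by simp [hi]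
    refine ⟨K, hK, fun s a => ?_, fun s a => ?_⟩ <;>
    · obtain ⟨b, hx, hy⟩ := key s a
      rw [← hx, ← hy]
      first | exact (h b).1 | exact (h b).2
  · rintro ⟨K, hK, h, h'⟩
    exact ⟨K, hK, fun a => ⟨h _ _, h' _ _⟩⟩

/-- `x` is `K`-equivalent to each of its subsequences. -/
def IsSubsymmetric (K : ℝ) (x : ℕ → E) : Prop :=
  ∀ φ : ℕ → ℕ, StrictMono φ → Dominated K (x ∘ φ) x ∧ Dominated K x (x ∘ φ)

end Domination

section Basis

variable {X : Type*} [NormedAddCommGroup X] [NormedSpace ℝ X]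

theorem coord_sum (e : SchauderBasis ℝ X) (s : Finset ℕ) (a : ℕ → ℝ) (j : ℕ) :
    e.coord j (∑ i ∈ s, a i • e i) = if j ∈ s then a j else 0 := by
  simp [e.ortho, Pi.single_apply]

theorem exists_norm_proj_le_pos [CompleteSpace X] (e : SchauderBasis ℝ X) :
    ∃ C : ℝ, 0 < C ∧ ∀ (n : ℕ) (x : X), ‖SchauderBasis.proj e n x‖ ≤ C * ‖x‖ := by
  obtain ⟨C, hC⟩ := SchauderBasis.exists_norm_proj_le e
  refine ⟨max C 1, by positivity, fun n x => ?_⟩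
  exact (ContinuousLinearMap.le_opNorm _ _).trans
    (mul_le_mul_of_nonneg_right ((hC n).trans (le_max_left _ _)) (norm_nonneg _))

theorem exists_abs_coord_le [CompleteSpace X] (e : SchauderBasis ℝ X) (he : ∀ i, ‖e i‖ = 1) :
    ∃ D : ℝ, 0 < D ∧ ∀ (i : ℕ) (x : X), |e.coord i x| ≤ D * ‖x‖ := by
  obtain ⟨C, hC, h⟩ := exists_norm_proj_le_pos e
  refine ⟨2 * C, by positivity, fun i x => ?_⟩
  have : e.coord i x • e i = SchauderBasis.proj e (i + 1) x - SchauderBasis.proj e i x := by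
    simp [Finset.sum_range_succ]
  calc |e.coord i x| = ‖e.coord i x • e i‖ := by rw [norm_smul, he, mul_one, Real.norm_eq_abs]
    _ ≤ ‖SchauderBasis.proj e (i + 1) x‖ + ‖SchauderBasis.proj e i x‖ := by
      rw [this]; exact norm_sub_le _ _
    _ ≤ 2 * C * ‖x‖ := by linarith [h (i + 1) x, h i x]

/-- For fixed coefficients `a`, the norm of `∑ a i • e (t i)` can be made almost independent of the
choice of `t` by passing to a subsequence. -/
theorem exists_strictMono_norm_sum_le [CompleteSpace X] (e : SchauderBasis ℝ X)
    (he : ∀ i, ‖e i‖ = 1) (s : Finset ℕ) (a : ℕ → ℝ) (M : ℕ → ℕ) (hM : StrictMono M) :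
    ∃ θ : ℕ → ℕ, StrictMono θ ∧ ∀ t t' : ℕ → ℕ, StrictMono t → StrictMono t' →
      ‖∑ i ∈ s, a i • e (M (θ (t i)))‖ ≤ 2 * ‖∑ i ∈ s, a i • e (M (θ (t' i)))‖ := by
  by_cases ha : ∀ i ∈ s, a i = 0
  · refine ⟨id, strictMono_id, fun t t' _ _ => ?_⟩
    rw [Finset.sum_eq_zero fun i hi => by rw [ha i hi, zero_smul]]
    simp
  push Not at ha
  obtain ⟨j, hj, haj⟩ := ha
  obtain ⟨D, hD, hcoord⟩ := exists_abs_coord_le e he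
  -- The norms are bounded below, so a small additive oscillation gives the factor `2`.
  have hlow (t : ℕ → ℕ) (ht : StrictMono t) : |a j| / D ≤ ‖∑ i ∈ s, a i • e (t i)‖ := by
    rw [div_le_iff₀' hD]
    refine le_trans (le_of_eq ?_) (hcoord (t j) _)
    rw [sum_comp_eq_sum_image e ht.injective, coord_sum, if_pos (Finset.mem_image_of_mem t hj),
      Function.leftInverse_invFun ht.injective]
  obtain ⟨θ, hθ, h⟩ := exists_strictMono_oscillation_le (s.sup id + 1)
    (fun t => ‖∑ i ∈ s, a i • e (M (t i))‖) (∑ i ∈ s, |a i|) (|a j| / D) (by positivity)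
    (fun t t' htt' => by
      refine congrArg _ (Finset.sum_congr rfl fun i hi => ?_)
      rw [htt' i (Nat.lt_succ_of_le (Finset.le_sup (f := id) hi))])
    (fun t => norm_nonneg _)
    (fun t => norm_sum_le_of_le _ fun i _ => by rw [norm_smul, he, mul_one, Real.norm_eq_abs])
  refine ⟨θ, hθ, fun t t' ht ht' => ?_⟩
  have h1 := h t t' ht ht'
  have h2 := hlow (M ∘ θ ∘ t') (hM.comp (hθ.comp ht'))
  simp only [Function.comp_apply] at h1 h2
  linarith

theorem isNormalizedBlockBasis_comp {e : ℕ → X} (he : ∀ i, ‖e i‖ = 1) {φ : ℕ → ℕ}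
    (hφ : StrictMono φ) : IsNormalizedBlockBasis e (e ∘ φ) := by
  classical
  refine ⟨⟨φ, fun j => if j ∈ Set.range φ then 1 else 0, hφ, fun n => ?_⟩, fun n => he _⟩
  rw [Finset.sum_eq_single (φ n)]
  · simp
  · intro j hj hne
    beta_reduce
    rw [if_neg, zero_smul]
    rintro ⟨m, rfl⟩
    rw [Finset.mem_Ico, hφ.le_iff_le, hφ.lt_iff_lt] at hj
    exact hne (by congr 1; omega)
  · intro h
    exact absurd (Finset.mem_Ico.2 ⟨le_rfl, hφ n.lt_succ_self⟩) h

theorem IsRosenthal.exists_dominated {e : SchauderBasis ℝ X} (he : IsRosenthal e) {x : ℕ → X}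
    (hx : IsNormalizedBlockBasis e x) : ∃ φ : ℕ → ℕ, StrictMono φ ∧ ∃ K : ℝ, 0 < K ∧
      Dominated K (x ∘ φ) e ∧ Dominated K e (x ∘ φ) := by
  obtain ⟨φ, hφ, h⟩ := he.2 x hx
  exact ⟨φ, hφ, equivalent_iff_dominated.1 h⟩

/-- Far enough out, all subsequences of a Rosenthal basis are uniformly equivalent. Otherwise pick,
for each `n`, coefficients and two subsequences beyond `n` for which the ratio of norms exceeds `n`.
Along some sequence `M` the norms for the chosen coefficients are stable up to the factor `2`, so no
subsequence of `e ∘ M` can be equivalent to `e`. -/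
theorem IsRosenthal.exists_dominated_tail [CompleteSpace X] {e : SchauderBasis ℝ X}
    (he : IsRosenthal e) : ∃ n : ℕ, ∀ φ ψ : ℕ → ℕ, StrictMono φ → StrictMono ψ →
      (∀ i, n ≤ φ i) → (∀ i, n ≤ ψ i) → Dominated (n : ℝ) (e ∘ φ) (e ∘ ψ) := by
  by_contra! hcon
  simp only [Dominated] at hcon
  push Not at hcon
  choose φ ψ hφ hψ hφn hψn s a hlt using hcon
  obtain ⟨M, hM, hstab⟩ := exists_strictMono_diagonal
    (fun n M => ∀ t t' : ℕ → ℕ, StrictMono t → StrictMono t' →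
      ‖∑ i ∈ s n, a n i • e (M (t i))‖ ≤ 2 * ‖∑ i ∈ s n, a n i • e (M (t' i))‖)
    (fun n M θ hθ h t t' ht ht' => h (θ ∘ t) (θ ∘ t') (hθ.comp ht) (hθ.comp ht'))
    (fun n M hM => exists_strictMono_norm_sum_le e he.1 (s n) (a n) M hM)
  obtain ⟨θ, hθ, K, hK, h1, h2⟩ := he.exists_dominated (isNormalizedBlockBasis_comp he.1 hM)
  obtain ⟨n, hn⟩ := exists_nat_gt (2 * K * K)
  have hshift (χ : ℕ → ℕ) (hχ : StrictMono χ) (hχn : ∀ i, n ≤ χ i) :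
      ∃ t, StrictMono t ∧ ∀ i, M (n + t i) = M (θ (χ i)) := by
    have hge (i : ℕ) : n ≤ θ (χ i) := (hχn i).trans (hθ.id_le _)
    refine ⟨fun i => θ (χ i) - n, fun i j hij => ?_, fun i => by rw [Nat.add_sub_cancel' (hge i)]⟩
    have h1 := hge i
    have h2 : θ (χ i) < θ (χ j) := hθ (hχ hij)
    show θ (χ i) - n < θ (χ j) - n
    omega
  obtain ⟨t, ht, htφ⟩ := hshift (φ n) (hφ n) (hφn n)
  obtain ⟨t', ht', htψ⟩ := hshift (ψ n) (hψ n) (hψn n)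
  have h3 := hstab n t t' ht ht'
  simp only [htφ, htψ] at h3
  have h4 := h2.comp (hφ n).injective (s n) (a n)
  have h5 := h1.comp (hψ n).injective (s n) (a n)
  have h6 := hlt n
  simp only [Function.comp_apply] at h4 h5 h6
  have h7 : ‖∑ i ∈ s n, a n i • e (φ n i)‖ ≤ 2 * K * K * ‖∑ i ∈ s n, a n i • e (ψ n i)‖ := by
    calc _ ≤ K * (2 * (K * ‖∑ i ∈ s n, a n i • e (ψ n i)‖)) := by
          refine h4.trans ?_
          gcongr
          exact h3.trans (by gcongr)
      _ = _ := by ring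
  have h8 := mul_le_mul_of_nonneg_right hn.le (norm_nonneg (∑ i ∈ s n, a n i • e (ψ n i)))
  linarith

/-- A Rosenthal basis is uniformly equivalent to its subsequences: it is equivalent to a subsequence
of one of its tails, where this holds. -/
theorem IsRosenthal.exists_isSubsymmetric [CompleteSpace X] {e : SchauderBasis ℝ X}
    (he : IsRosenthal e) : ∃ K : ℝ, 0 < K ∧ IsSubsymmetric K e := by
  obtain ⟨n, hn⟩ := he.exists_dominated_tail
  have hadd : StrictMono fun i => n + i := fun i j h => Nat.add_lt_add_left h n
  obtain ⟨θ, hθ, K, hK, h1, h2⟩ := he.exists_dominated (isNormalizedBlockBasis_comp he.1 hadd)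
  refine ⟨K * (n + 1) * K, by positivity, fun φ hφ => ?_⟩
  have key (χ χ' : ℕ → ℕ) (hχ : StrictMono χ) (hχ' : StrictMono χ') :
      Dominated ((n : ℝ) + 1) ((e ∘ (fun i => n + i) ∘ θ) ∘ χ) ((e ∘ (fun i => n + i) ∘ θ) ∘ χ') :=
    (hn _ _ (hadd.comp (hθ.comp hχ)) (hadd.comp (hθ.comp hχ')) (fun i => Nat.le_add_right _ _)
      (fun i => Nat.le_add_right _ _)).mono (by linarith)
  constructor
  · exact ((h2.comp hφ.injective).trans hK.le (key φ id hφ strictMono_id)).trans (by positivity) h1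
  · exact (h2.trans hK.le (key id φ strictMono_id hφ)).trans (by positivity) (h1.comp hφ.injective)

end Basis

/-! ### Unconditionality -/

section Unconditional

variable {E F : Type*} [NormedAddCommGroup E] [NormedSpace ℝ E] [NormedAddCommGroup F]
  [NormedSpace ℝ F]

/-- `x` is suppression unconditional with constant `K`: omitting terms from a linear combination
multiplies the norm by at most `K`. -/
def IsUnconditional (K : ℝ) (x : ℕ → E) : Prop :=
  ∀ s t : Finset ℕ, s ⊆ t → ∀ a : ℕ → ℝ, ‖∑ i ∈ s, a i • x i‖ ≤ K * ‖∑ i ∈ t, a i • x i‖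

theorem IsUnconditional.smul {K : ℝ} {x : ℕ → E} (h : IsUnconditional K x) (c : ℕ → ℝ) :
    IsUnconditional K fun i => c i • x i := fun s t hst a => by
  simpa only [smul_smul] using h s t hst fun i => a i * c i

theorem IsUnconditional.comp {K : ℝ} {x : ℕ → E} (h : IsUnconditional K x) {φ : ℕ → ℕ}
    (hφ : Function.Injective φ) : IsUnconditional K (x ∘ φ) := fun s t hst a => by
  simpa only [Function.comp_apply, sum_comp_eq_sum_image _ hφ] using
    h (s.image φ) (t.image φ) (Finset.image_subset_image hst) fun j => a (Function.invFun φ j)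

theorem IsUnconditional.of_dominated {K L : ℝ} {x : ℕ → E} {y : ℕ → F} (hK : 0 ≤ K) (hL : 0 ≤ L)
    (hxy : Dominated K x y) (hyx : Dominated K y x) (h : IsUnconditional L y) :
    IsUnconditional (K * L * K) x := fun s t hst a =>
  calc ‖∑ i ∈ s, a i • x i‖ ≤ K * (L * (K * ‖∑ i ∈ t, a i • x i‖)) := by
        refine (hxy s a).trans ?_
        gcongr
        refine (h s t hst a).trans ?_
        gcongr
        exact hyx t a
    _ = K * L * K * ‖∑ i ∈ t, a i • x i‖ := by ring

/-- If all subsums of a finite family are bounded, then so are the combinations with bounded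
coefficients. -/
theorem norm_sum_smul_le_of_subsums (z : ℕ → E) (t : Finset ℕ) {B : ℝ}
    (h : ∀ s ⊆ t, ‖∑ i ∈ s, z i‖ ≤ B) (c : ℕ → ℝ) {m : ℝ} (hm : 0 ≤ m)
    (hc : ∀ i ∈ t, |c i| ≤ m) : ‖∑ i ∈ t, c i • z i‖ ≤ 2 * B * m := by
  obtain ⟨f, hf, hfx⟩ := exists_dual_vector'' ℝ (∑ i ∈ t, c i • z i)
  have hfB (s) (hs : s ⊆ t) : |∑ i ∈ s, f (z i)| ≤ B := by
    rw [← map_sum, ← Real.norm_eq_abs]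
    refine (f.le_opNorm _).trans ?_
    nlinarith [h s hs, norm_nonneg (∑ i ∈ s, z i), norm_nonneg f]
  have habs : ∑ i ∈ t, |f (z i)| ≤ 2 * B := by
    rw [← Finset.sum_filter_add_sum_filter_not t fun i => 0 ≤ f (z i),
      Finset.sum_congr rfl fun i hi => abs_of_nonneg (Finset.mem_filter.1 hi).2,
      Finset.sum_congr (s₁ := t.filter fun i => ¬0 ≤ f (z i)) rfl
        fun i hi => abs_of_neg (not_le.1 (Finset.mem_filter.1 hi).2), Finset.sum_neg_distrib]
    have h1 := le_abs_self (∑ i ∈ t.filter fun i => 0 ≤ f (z i), f (z i))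
    have h2 := neg_abs_le (∑ i ∈ t.filter fun i => ¬0 ≤ f (z i), f (z i))
    linarith [hfB _ (t.filter_subset fun i => 0 ≤ f (z i)),
      hfB _ (t.filter_subset fun i => ¬0 ≤ f (z i))]
  have hfx' : ‖∑ i ∈ t, c i • z i‖ = ∑ i ∈ t, c i * f (z i) := by
    have : f (∑ i ∈ t, c i • z i) = ‖∑ i ∈ t, c i • z i‖ := by simpa using hfx
    rw [← this]
    simp
  rw [hfx']
  calc ∑ i ∈ t, c i * f (z i) ≤ ∑ i ∈ t, |f (z i)| * m := Finset.sum_le_sum fun i hi => by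
        refine (le_abs_self _).trans ?_
        rw [abs_mul, mul_comm]
        exact mul_le_mul_of_nonneg_left (hc i hi) (abs_nonneg _)
    _ = (∑ i ∈ t, |f (z i)|) * m := (Finset.sum_mul ..).symm
    _ ≤ 2 * B * m := mul_le_mul_of_nonneg_right habs hm

theorem Dominated.norm_sum_smul_sub_le {K : ℝ} {x : ℕ → E} {y : ℕ → F} (h : Dominated K x y)
    (s : Finset ℕ) (a : ℕ → ℝ) (p q : ℕ → ℕ) :
    ‖∑ i ∈ s, a i • (x (p i) - x (q i))‖ ≤ K * ‖∑ i ∈ s, a i • (y (p i) - y (q i))‖ := by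
  let b : ℕ →₀ ℝ := ∑ i ∈ s, a i • (Finsupp.single (p i) 1 - Finsupp.single (q i) 1)
  have h1 := h b.support b
  have hx : Finsupp.linearCombination ℝ x b = ∑ i ∈ s, a i • (x (p i) - x (q i)) := by simp [b]
  have hy : Finsupp.linearCombination ℝ y b = ∑ i ∈ s, a i • (y (p i) - y (q i)) := by simp [b]
  rwa [← hx, ← hy]

/-- Differences of a bounded subsymmetric sequence are unconditional: a term `e (2 i) - e (2 i + 1)`
is removed, up to constants, by averaging over `n` consecutive translates of it, which telescope to
two vectors divided by `n`. -/
theorem IsSubsymmetric.isUnconditional_sub {K : ℝ} {e : ℕ → E} (hK : 0 ≤ K)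
    (h : IsSubsymmetric K e) (he : ∀ i, ‖e i‖ ≤ 1) :
    IsUnconditional (K * K) fun i => e (2 * i) - e (2 * i + 1) := by
  classical
  intro s t hst a
  -- The `i`-th difference lives in a window of length `n + 2`; those in `t \ s` are moved by `τ`.
  let φ : ℕ → ℕ → ℕ → ℕ := fun n τ i =>
    i / 2 * (n + 2) + i % 2 + if i / 2 ∈ s then 0 else τ
  have hφ (n τ) (hτ : τ ≤ n) : StrictMono (φ n τ) := by
    refine strictMono_nat_of_lt_succ fun i => ?_
    simp only [φ]
    rcases Nat.even_or_odd' i with ⟨m, rfl | rfl⟩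
    · rw [show (2 * m + 1) / 2 = m by omega, show 2 * m / 2 = m by omega]
      omega
    · rw [show (2 * m + 1 + 1) / 2 = m + 1 by omega, show (2 * m + 1) / 2 = m by omega, add_mul]
      split_ifs <;> omega
  have h0 (n τ i) : φ n τ (2 * i) = i * (n + 2) + if i ∈ s then 0 else τ := by
    simp [φ]
  have h1 (n τ i) : φ n τ (2 * i + 1) = i * (n + 2) + 1 + if i ∈ s then 0 else τ := by
    simp only [φ]
    rw [show (2 * i + 1) / 2 = i by omega, show (2 * i + 1) % 2 = 1 by omega]
  set A := ‖∑ i ∈ t, a i • (e (2 * i) - e (2 * i + 1))‖ with hA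
  have hmain (n : ℕ) : (n + 1 : ℕ) * ‖∑ i ∈ s, a i • (e (2 * i) - e (2 * i + 1))‖ ≤
      (n + 1 : ℕ) * (K * K * A) + K * ∑ i ∈ t \ s, |a i| * 2 := by
    set u : ℕ → E := fun i => a i • (e (i * (n + 1 + 2)) - e (i * (n + 1 + 2) + 1)) with hu
    set w : ℕ → E := fun i => a i • (e (i * (n + 1 + 2)) - e (i * (n + 1 + 2) + (n + 1))) with hw
    have hsum : ∑ τ ∈ Finset.range (n + 1),
        ∑ i ∈ t, a i • (e (φ (n + 1) τ (2 * i)) - e (φ (n + 1) τ (2 * i + 1))) =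
          (n + 1 : ℕ) • ∑ i ∈ s, u i + ∑ i ∈ t \ s, w i := by
      rw [Finset.sum_comm, ← Finset.sum_sdiff hst, add_comm, Finset.smul_sum]
      congr 1
      · refine Finset.sum_congr rfl fun i hi => ?_
        simp [h0, h1, hi, hu]
      · refine Finset.sum_congr rfl fun i hi => ?_
        have hi' := (Finset.mem_sdiff.1 hi).2
        simp only [h0, h1, hi', if_false, ← Finset.smul_sum, hw]
        congr 1
        have := Finset.sum_range_sub' (fun τ => e (i * (n + 1 + 2) + τ)) (n + 1)
        simpa only [add_zero, add_assoc, add_comm 1] using this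
    have hup : ‖(n + 1 : ℕ) • ∑ i ∈ s, u i + ∑ i ∈ t \ s, w i‖ ≤ (n + 1 : ℕ) * (K * A) := by
      rw [← hsum]
      refine (norm_sum_le_of_le _ (f := _) (n := fun _ => K * A) fun τ hτ => ?_).trans (by simp)
      exact (h _ (hφ (n + 1) τ (Finset.mem_range.1 hτ).le)).1.norm_sum_smul_sub_le t a _ _
    have hw' : ‖∑ i ∈ t \ s, w i‖ ≤ ∑ i ∈ t \ s, |a i| * 2 := by
      refine norm_sum_le_of_le _ fun i _ => ?_
      rw [hw, norm_smul, Real.norm_eq_abs]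
      gcongr
      refine (norm_sub_le _ _).trans ?_
      linarith [he (i * (n + 1 + 2)), he (i * (n + 1 + 2) + (n + 1))]
    have hs : ‖∑ i ∈ s, a i • (e (2 * i) - e (2 * i + 1))‖ ≤ K * ‖∑ i ∈ s, u i‖ := by
      have := (h _ (hφ (n + 1) 0 (by omega))).2.norm_sum_smul_sub_le s a
        (fun i => 2 * i) fun i => 2 * i + 1
      simpa [h0, h1] using this
    have h3 : (n + 1 : ℕ) * ‖∑ i ∈ s, u i‖ ≤ (n + 1 : ℕ) * (K * A) + ∑ i ∈ t \ s, |a i| * 2 := by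
      have := norm_sub_le ((n + 1 : ℕ) • ∑ i ∈ s, u i + ∑ i ∈ t \ s, w i) (∑ i ∈ t \ s, w i)
      rw [add_sub_cancel_right, ← Nat.cast_smul_eq_nsmul ℝ, norm_smul, Real.norm_natCast,
        Nat.cast_smul_eq_nsmul ℝ] at this
      linarith
    calc (n + 1 : ℕ) * ‖∑ i ∈ s, a i • (e (2 * i) - e (2 * i + 1))‖
        ≤ (n + 1 : ℕ) * (K * ‖∑ i ∈ s, u i‖) := by gcongr
      _ = K * ((n + 1 : ℕ) * ‖∑ i ∈ s, u i‖) := by ring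
      _ ≤ K * ((n + 1 : ℕ) * (K * A) + ∑ i ∈ t \ s, |a i| * 2) := by gcongr
      _ = _ := by ring
  have hlim : Tendsto (fun n : ℕ => K * K * A + (K * ∑ i ∈ t \ s, |a i| * 2) / ((n : ℝ) + 1)) atTop
      (𝓝 (K * K * A)) := by
    simpa [div_eq_mul_inv] using ((tendsto_one_div_add_atTop_nhds_zero_nat (𝕜 := ℝ)).const_mul
      (K * ∑ i ∈ t \ s, |a i| * 2)).const_add (K * K * A)
  refine ge_of_tendsto' hlim fun n => ?_
  have hn : (0 : ℝ) < (n : ℝ) + 1 := by positivity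
  have h4 := hmain n
  push_cast at h4
  have h5 : K * K * A + (K * ∑ i ∈ t \ s, |a i| * 2) / ((n : ℝ) + 1) =
      (((n : ℝ) + 1) * (K * K * A) + K * ∑ i ∈ t \ s, |a i| * 2) / ((n : ℝ) + 1) := by
    rw [add_div, mul_div_cancel_left₀ _ hn.ne']
  rw [h5, le_div_iff₀' hn]
  exact h4

end Unconditional

/-! ### Normalized block bases -/

section Blocks

variable {X : Type*} [NormedAddCommGroup X] [NormedSpace ℝ X]

theorem isNormalizedBlockBasis_of_blocks {e x : ℕ → X} (p : ℕ → ℕ) (hp : StrictMono p)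
    (b : ℕ → ℕ → ℝ) (hx : ∀ n, x n = ∑ j ∈ Finset.Ico (p n) (p (n + 1)), b n j • e j)
    (hnorm : ∀ n, ‖x n‖ = 1) : IsNormalizedBlockBasis e x := by
  -- The coefficient at `j` comes from the only block containing `j`, whose number is at most `j`.
  refine ⟨⟨p, fun j => ∑ k ∈ Finset.range (j + 1),
    if j ∈ Finset.Ico (p k) (p (k + 1)) then b k j else 0, hp, fun n => ?_⟩, hnorm⟩
  rw [hx]
  refine Finset.sum_congr rfl fun j hj => ?_
  congr 1
  beta_reduce
  rw [Finset.sum_eq_single n, if_pos hj]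
  · intro k _ hkn
    refine if_neg fun hk => hkn ?_
    rw [Finset.mem_Ico] at hj hk
    rcases lt_trichotomy k n with h | h | h
    · have := hp.monotone (Nat.succ_le_of_lt h); simp only [Nat.succ_eq_add_one] at this; omega
    · exact h
    · have := hp.monotone (Nat.succ_le_of_lt h); simp only [Nat.succ_eq_add_one] at this; omega
  · intro hn
    have := hp.id_le n
    simp only [Finset.mem_range, Finset.mem_Ico, id_eq] at hn hj this
    omega

/-- Build a normalized block basis one block at a time: `Q k p q v` is what is required of the
`k`-th block `v`, supported in `[p, q)`. -/
theorem exists_isNormalizedBlockBasis (e : ℕ → X) (Q : ℕ → ℕ → ℕ → X → Prop)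
    (h : ∀ k p, ∃ q, p < q ∧ ∃ b : ℕ → ℝ, ‖∑ j ∈ Finset.Ico p q, b j • e j‖ = 1 ∧
      Q k p q (∑ j ∈ Finset.Ico p q, b j • e j)) :
    ∃ (p : ℕ → ℕ) (x : ℕ → X), StrictMono p ∧ IsNormalizedBlockBasis e x ∧
      ∀ k, Q k (p k) (p (k + 1)) (x k) := by
  choose q hq b hb hQ using h
  let p : ℕ → ℕ := fun n => Nat.rec 0 (fun k m => q k m) n
  have hp : StrictMono p := strictMono_nat_of_lt_succ fun n => hq n (p n)
  exact ⟨p, _, hp, isNormalizedBlockBasis_of_blocks p hp (fun n => b n (p n)) (fun n => rfl)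
    fun n => hb n (p n), fun k => hQ k (p k)⟩

/-- A Rosenthal basis is unconditional: it is subsymmetric, so its differences are unconditional,
and some subsequence of the normalized differences is equivalent to the basis. -/
theorem IsRosenthal.exists_isUnconditional [CompleteSpace X] {e : SchauderBasis ℝ X}
    (he : IsRosenthal e) : ∃ L : ℝ, 0 < L ∧ IsUnconditional L e := by
  obtain ⟨K, hK, hsub⟩ := he.exists_isSubsymmetric
  have hunc := hsub.isUnconditional_sub hK.le fun i => (he.1 i).le
  have hne (i : ℕ) : e (2 * i) - e (2 * i + 1) ≠ 0 := fun h => by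
    have := congrArg (e.coord (2 * i)) h
    simp [e.ortho] at this
  have hsum (i : ℕ) (c : ℝ) : c • (e (2 * i) - e (2 * i + 1)) =
      ∑ j ∈ Finset.Ico (2 * i) (2 * (i + 1)), (if j = 2 * i then c else -c) • e j := by
    rw [show 2 * (i + 1) = 2 * i + 1 + 1 by ring, Finset.sum_Ico_succ_top (by omega),
      Finset.sum_Ico_succ_top le_rfl]
    simp [sub_eq_add_neg]
  have hblock : IsNormalizedBlockBasis e
      fun i => ‖e (2 * i) - e (2 * i + 1)‖⁻¹ • (e (2 * i) - e (2 * i + 1)) :=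
    isNormalizedBlockBasis_of_blocks (fun i => 2 * i) (fun i j hij => by dsimp only; omega) _
      (fun i => hsum i _) fun i => norm_smul_inv_norm (𝕜 := ℝ) (hne i)
  obtain ⟨φ, hφ, M, hM, h1, h2⟩ := he.exists_dominated hblock
  exact ⟨M * (K * K) * M, by positivity,
    .of_dominated hM.le (by positivity) h2 h1 ((hunc.smul _).comp hφ.injective)⟩

end Blocks

/-! ### The unit vector bases of `c₀` and `ℓ₁` -/

theorem sum_c0UnitVector_apply (s : Finset ℕ) (a : ℕ → ℝ) (j : ℕ) :
    (∑ i ∈ s, a i • c0UnitVector i) j = if j ∈ s then a j else 0 := by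
  have hcoe : (∑ i ∈ s, a i • c0UnitVector i) j = ∑ i ∈ s, (a i • c0UnitVector i) j := by
    induction s using Finset.cons_induction with
    | empty => simp
    | cons i s hi ih =>
      rw [Finset.sum_cons, Finset.sum_cons, ZeroAtInftyContinuousMap.add_apply, ih]
  have happ (i : ℕ) : c0UnitVector i j = Pi.single (M := fun _ => ℝ) i 1 j := rfl
  rw [hcoe]
  simp [happ, Pi.single_apply]

theorem norm_sum_c0UnitVector_le (s : Finset ℕ) (a : ℕ → ℝ) {r : ℝ} (hr : 0 ≤ r)
    (h : ∀ i ∈ s, |a i| ≤ r) : ‖∑ i ∈ s, a i • c0UnitVector i‖ ≤ r := by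
  rw [← ZeroAtInftyContinuousMap.norm_toBCF_eq_norm, BoundedContinuousFunction.norm_le hr]
  intro j
  change |(∑ i ∈ s, a i • c0UnitVector i) j| ≤ r
  rw [sum_c0UnitVector_apply]
  split_ifs with hj
  · exact h j hj
  · simpa using hr

theorem abs_le_norm_sum_c0UnitVector (s : Finset ℕ) (a : ℕ → ℝ) {j : ℕ} (hj : j ∈ s) :
    |a j| ≤ ‖∑ i ∈ s, a i • c0UnitVector i‖ := by
  rw [← ZeroAtInftyContinuousMap.norm_toBCF_eq_norm]
  refine le_trans (le_of_eq ?_) (BoundedContinuousFunction.norm_coe_le_norm _ j)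
  change |a j| = |(∑ i ∈ s, a i • c0UnitVector i) j|
  rw [sum_c0UnitVector_apply, if_pos hj]

theorem norm_sum_l1UnitVector (s : Finset ℕ) (a : ℕ → ℝ) :
    ‖∑ i ∈ s, a i • l1UnitVector i‖ = ∑ i ∈ s, |a i| := by
  have h := lp.norm_sum_single (E := fun _ : ℕ => ℝ) (p := 1) (by simp) a s
  simp only [ENNReal.toReal_one, Real.rpow_one, Real.norm_eq_abs] at h
  rw [← h]
  congr 1
  refine Finset.sum_congr rfl fun i _ => ?_
  rw [l1UnitVector, ← lp.single_smul, smul_eq_mul, mul_one]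

/-! ### James' dichotomies and reflexivity -/

section James

variable {X : Type*} [NormedAddCommGroup X] [NormedSpace ℝ X]

/-- A basis is shrinking if every functional is the norm limit of its restrictions to the spans of
the first `n` basis vectors. -/
def IsShrinking (e : SchauderBasis ℝ X) : Prop :=
  ∀ f : StrongDual ℝ X, Tendsto (fun n => ‖f - f.comp (SchauderBasis.proj e n)‖) atTop (𝓝 0)

/-- A sequence is boundedly complete if every series in it with bounded partial sums converges. -/
def IsBoundedlyComplete (e : ℕ → X) : Prop :=
  ∀ (a : ℕ → ℝ) (B : ℝ), (∀ n, ‖∑ i ∈ Finset.range n, a i • e i‖ ≤ B) →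
    ∃ x, Tendsto (fun n => ∑ i ∈ Finset.range n, a i • e i) atTop (𝓝 x)

/-- James' theorem: a space with a shrinking and boundedly complete basis is reflexive. -/
theorem isReflexive_of_isShrinking_of_isBoundedlyComplete [CompleteSpace X]
    (e : SchauderBasis ℝ X) (hs : IsShrinking e) (hb : IsBoundedlyComplete e) : IsReflexive X := by
  intro F
  obtain ⟨C, hC, hproj⟩ := exists_norm_proj_le_pos e
  have hF (f : StrongDual ℝ X) (n : ℕ) :
      f (∑ i ∈ Finset.range n, F (e.coord i) • e i) = F (f.comp (SchauderBasis.proj e n)) := by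
    have : f.comp (SchauderBasis.proj e n) = ∑ i ∈ Finset.range n, f (e i) • e.coord i := by
      ext x
      simp [mul_comm]
    rw [this]
    simp [mul_comm]
  obtain ⟨x, hx⟩ := hb (fun i => F (e.coord i)) (‖F‖ * C) fun n => by
    refine NormedSpace.norm_le_dual_bound ℝ _ (by positivity) fun f => ?_
    rw [hF, mul_assoc]
    refine (F.le_opNorm _).trans ?_
    gcongr
    refine ContinuousLinearMap.opNorm_le_bound _ (by positivity) fun x => ?_
    rw [ContinuousLinearMap.comp_apply, mul_comm C, mul_assoc]
    exact (f.le_opNorm _).trans (by gcongr; exact hproj n x)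
  refine ⟨x, ?_⟩
  ext f
  rw [NormedSpace.dual_def]
  have h1 : Tendsto (fun n => F (f.comp (SchauderBasis.proj e n))) atTop (𝓝 (f x)) := by
    simp only [← hF]
    exact (f.continuous.tendsto x).comp hx
  have h2 : Tendsto (fun n => F (f.comp (SchauderBasis.proj e n))) atTop (𝓝 (F f)) :=
    (F.continuous.tendsto f).comp (tendsto_iff_norm_sub_tendsto_zero.2
      (by simpa only [norm_sub_rev] using hs f))
  exact tendsto_nhds_unique h1 h2

/-- If a basis is not shrinking, some functional is bounded below on a normalized block basis. -/
theorem exists_isNormalizedBlockBasis_of_not_isShrinking [CompleteSpace X]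
    (e : SchauderBasis ℝ X) (h : ¬IsShrinking e) :
    ∃ (f : StrongDual ℝ X) (δ : ℝ) (x : ℕ → X), 0 < δ ∧ IsNormalizedBlockBasis e x ∧
      ∀ n, δ ≤ f (x n) := by
  simp only [IsShrinking] at h
  push Not at h
  obtain ⟨f, hf⟩ := h
  obtain ⟨C, hC, hproj⟩ := exists_norm_proj_le_pos e
  obtain ⟨δ, hδ, hfreq⟩ : ∃ δ > 0, ∃ᶠ n in atTop, δ ≤ ‖f - f.comp (SchauderBasis.proj e n)‖ := by
    by_contra! hcon
    refine hf ?_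
    rw [Metric.tendsto_nhds]
    intro ε hε
    filter_upwards [hcon ε hε] with n hn
    simpa using hn
  obtain ⟨_, x, _, hx, hfx⟩ := exists_isNormalizedBlockBasis e
    (fun _ _ _ v => δ / 4 / (C * (1 + C)) ≤ f v) fun _ p => by
      obtain ⟨n, hpn, hn⟩ := frequently_atTop.1 hfreq p
      obtain ⟨y, hy, hyf⟩ : ∃ y : X, ‖y‖ < 1 ∧
          δ / 2 < (f - f.comp (SchauderBasis.proj e n)) y := by
        obtain ⟨y, hy, hyf⟩ := (f - f.comp (SchauderBasis.proj e n)).exists_lt_apply_of_lt_opNorm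
          (r := δ / 2) (by linarith)
        rw [Real.norm_eq_abs] at hyf
        rcases lt_abs.1 hyf with h | h
        · exact ⟨y, hy, h⟩
        · exact ⟨-y, by simpa using hy, by rwa [map_neg]⟩
      set w := y - SchauderBasis.proj e n y with hw
      have hwn : ‖w‖ ≤ 1 + C := by
        have := norm_sub_le y (SchauderBasis.proj e n y)
        nlinarith [hproj n y]
      have hfw : δ / 2 < f w := by simpa [hw] using hyf
      have hlim : Tendsto (fun q => f (SchauderBasis.proj e q w)) atTop (𝓝 (f w)) :=
        (f.continuous.tendsto w).comp (SchauderBasis.tendsto_proj e w)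
      obtain ⟨q, hq, hnq⟩ := ((hlim.eventually_const_lt hfw).and (eventually_gt_atTop n)).exists
      set z := SchauderBasis.proj e q w with hz
      have hzsum : z = ∑ j ∈ Finset.Ico p q, e.coord j w • e j := by
        rw [hz, SchauderBasis.proj_apply, ← Finset.sum_range_add_sum_Ico _ (hpn.trans hnq.le),
          Finset.sum_eq_zero, zero_add]
        intro j hj
        have : j < n := (Finset.mem_range.1 hj).trans_le hpn
        rw [hw, map_sub, SchauderBasis.proj_apply, coord_sum, if_pos (Finset.mem_range.2 this),
          sub_self, zero_smul]
      have hz0 : 0 < ‖z‖ := norm_pos_iff.2 fun h => by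
        rw [h, map_zero] at hq
        linarith
      have hzC : ‖z‖ ≤ C * (1 + C) := (hproj q w).trans (by gcongr)
      have hsum : ∑ j ∈ Finset.Ico p q, (‖z‖⁻¹ * e.coord j w) • e j = ‖z‖⁻¹ • z := by
        rw [hzsum, Finset.smul_sum]
        simp only [smul_smul]
      refine ⟨q, hpn.trans_lt hnq, fun j => ‖z‖⁻¹ * e.coord j w, ?_, ?_⟩
      · rw [hsum]
        exact norm_smul_inv_norm (𝕜 := ℝ) (norm_pos_iff.1 hz0)
      · rw [hsum, map_smul, smul_eq_mul, inv_mul_eq_div]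
        exact div_le_div₀ (by linarith) (by linarith) hz0 hzC
  exact ⟨f, _, x, by positivity, hx, hfx⟩

/-- If an unconditional sequence is not boundedly complete, some normalized block basis has an
upper `c₀`-estimate: normalize blocks of a divergent series with bounded partial sums. -/
theorem exists_isNormalizedBlockBasis_of_not_isBoundedlyComplete [CompleteSpace X] (e : ℕ → X)
    {L : ℝ} (hL : 0 < L) (hunc : IsUnconditional L e) (h : ¬IsBoundedlyComplete e) :
    ∃ (B : ℝ) (x : ℕ → X), 0 < B ∧ IsNormalizedBlockBasis e x ∧
      ∀ (s : Finset ℕ) (c : ℕ → ℝ) (m : ℝ), 0 ≤ m → (∀ i ∈ s, |c i| ≤ m) →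
        ‖∑ i ∈ s, c i • x i‖ ≤ B * m := by
  classical
  simp only [IsBoundedlyComplete] at h
  push Not at h
  obtain ⟨a, B, hB, hdiv⟩ := h
  have hncauchy : ¬CauchySeq fun n => ∑ i ∈ Finset.range n, a i • e i := fun hc =>
    let ⟨x, hx⟩ := cauchySeq_tendsto_of_complete hc
    hdiv x hx
  rw [Metric.cauchySeq_iff'] at hncauchy
  push Not at hncauchy
  obtain ⟨δ, hδ, hgap⟩ := hncauchy
  obtain ⟨p, x, hp, hx, hQ⟩ := exists_isNormalizedBlockBasis e
    (fun _ p q v => δ ≤ ‖∑ j ∈ Finset.Ico p q, a j • e j‖ ∧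
      v = ‖∑ j ∈ Finset.Ico p q, a j • e j‖⁻¹ • ∑ j ∈ Finset.Ico p q, a j • e j) fun _ p => by
      obtain ⟨q, hpq, hq⟩ := hgap p
      rw [dist_eq_norm, ← Finset.sum_Ico_eq_sub _ hpq] at hq
      set z := ∑ j ∈ Finset.Ico p q, a j • e j with hz
      have hz0 : z ≠ 0 := norm_pos_iff.1 (hδ.trans_le hq)
      have hsum : ∑ j ∈ Finset.Ico p q, (‖z‖⁻¹ * a j) • e j = ‖z‖⁻¹ • z := by
        rw [hz, Finset.smul_sum]
        simp only [smul_smul]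
      refine ⟨q, lt_of_le_of_ne hpq fun h => hz0 (by simp [hz, h]), _, ?_, hq, hsum⟩
      rw [hsum]
      exact norm_smul_inv_norm (𝕜 := ℝ) hz0
  have hB0 : 0 ≤ B := (norm_nonneg _).trans (hB 0)
  refine ⟨2 * (L * B) * δ⁻¹ + 1, x, by positivity, hx, fun s c m hm hc => ?_⟩
  set z : ℕ → X := fun k => ∑ j ∈ Finset.Ico (p k) (p (k + 1)), a j • e j with hz
  have hsub (s : Finset ℕ) : ‖∑ k ∈ s, z k‖ ≤ L * B := by
    rw [hz, ← Finset.sum_biUnion]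
    · refine (hunc _ (Finset.range (p (s.sup id + 1))) ?_ a).trans (by gcongr; exact hB _)
      intro j hj
      obtain ⟨k, hk, hjk⟩ := Finset.mem_biUnion.1 hj
      rw [Finset.mem_range]
      exact (Finset.mem_Ico.1 hjk).2.trans_le
        (hp.monotone (Nat.succ_le_succ (Finset.le_sup (f := id) hk)))
    · intro i _ j _ hij
      simp only [Function.onFun, ← Finset.disjoint_coe, Finset.coe_Ico]
      exact Monotone.pairwise_disjoint_on_Ico_succ hp.monotone hij
  have hxz : ∑ i ∈ s, c i • x i = ∑ i ∈ s, (c i * ‖z i‖⁻¹) • z i :=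
    Finset.sum_congr rfl fun i _ => by rw [(hQ i).2, smul_smul]
  rw [hxz]
  refine (norm_sum_smul_le_of_subsums z s (fun s _ => hsub s) _ (m := m * δ⁻¹) (by positivity)
    fun i hi => ?_).trans (by nlinarith)
  rw [abs_mul, abs_inv, abs_norm]
  exact mul_le_mul (hc i hi) (inv_anti₀ hδ (hQ i).1) (by positivity) hm

/-- A normalized block basis on which a functional is bounded below passes its lower `ℓ₁`-estimate
for nonnegative coefficients on to `e`; unconditionality takes care of the signs. -/
theorem IsRosenthal.equivalent_l1UnitVector [CompleteSpace X] {e : SchauderBasis ℝ X}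
    (he : IsRosenthal e) (h : ¬IsShrinking e) : Equivalent e l1UnitVector := by
  obtain ⟨L, hL, hunc⟩ := he.exists_isUnconditional
  obtain ⟨f, δ, x, hδ, hx, hfx⟩ := exists_isNormalizedBlockBasis_of_not_isShrinking e h
  obtain ⟨φ, hφ, K, hK, hxe, _⟩ := he.exists_dominated hx
  have hlow : Dominated (‖f‖ * K * (2 * L) / δ) l1UnitVector e := fun s a => by
    rw [norm_sum_l1UnitVector, div_mul_eq_mul_div, le_div_iff₀' hδ]
    have habs : ‖∑ i ∈ s, |a i| • e i‖ ≤ 2 * L * ‖∑ i ∈ s, a i • e i‖ := by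
      have := norm_sum_smul_le_of_subsums (fun i => a i • e i) s (fun t ht => hunc t s ht a)
        (fun i => SignType.sign (a i)) zero_le_one fun i _ => by
          rcases lt_trichotomy (a i) 0 with h | h | h <;> simp [h]
      simpa only [smul_smul, sign_mul_self, mul_one, mul_assoc] using this
    calc δ * ∑ i ∈ s, |a i| ≤ f (∑ i ∈ s, |a i| • x (φ i)) := by
          rw [map_sum, Finset.mul_sum]
          refine Finset.sum_le_sum fun i _ => ?_
          rw [map_smul, smul_eq_mul, mul_comm]
          exact mul_le_mul_of_nonneg_left (hfx _) (abs_nonneg _)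
      _ ≤ ‖f‖ * ‖∑ i ∈ s, |a i| • x (φ i)‖ := (le_abs_self _).trans (f.le_opNorm _)
      _ ≤ ‖f‖ * (K * (2 * L * ‖∑ i ∈ s, a i • e i‖)) := by
          gcongr
          exact (hxe s fun i => |a i|).trans (by gcongr)
      _ = _ := by ring
  have hup : Dominated 1 e l1UnitVector := fun s a => by
    rw [norm_sum_l1UnitVector, one_mul]
    exact norm_sum_le_of_le _ fun i _ => by rw [norm_smul, he.1, mul_one, Real.norm_eq_abs]
  exact equivalent_iff_dominated.2 ⟨max 1 (‖f‖ * K * (2 * L) / δ), by positivity,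
    hup.mono (le_max_left _ _), hlow.mono (le_max_right _ _)⟩

theorem IsRosenthal.equivalent_c0UnitVector [CompleteSpace X] {e : SchauderBasis ℝ X}
    (he : IsRosenthal e) (h : ¬IsBoundedlyComplete e) : Equivalent e c0UnitVector := by
  classical
  obtain ⟨L, hL, hunc⟩ := he.exists_isUnconditional
  obtain ⟨D, hD, hcoord⟩ := exists_abs_coord_le e he.1
  obtain ⟨B, x, hB, hx, hxB⟩ := exists_isNormalizedBlockBasis_of_not_isBoundedlyComplete e hL hunc h
  obtain ⟨φ, hφ, K, hK, _, hex⟩ := he.exists_dominated hx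
  have hup : Dominated (K * B) e c0UnitVector := fun s a => by
    refine (hex s a).trans ?_
    rw [mul_assoc]
    gcongr
    simp only [Function.comp_apply, sum_comp_eq_sum_image x hφ.injective]
    refine hxB _ _ _ (norm_nonneg _) fun j hj => ?_
    obtain ⟨i, hi, rfl⟩ := Finset.mem_image.1 hj
    rw [Function.leftInverse_invFun hφ.injective]
    exact abs_le_norm_sum_c0UnitVector s a hi
  have hlow : Dominated D c0UnitVector e := fun s a =>
    norm_sum_c0UnitVector_le s a (by positivity) fun i hi => by
      simpa only [coord_sum, if_pos hi] using hcoord i (∑ i ∈ s, a i • e i)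
  exact equivalent_iff_dominated.2 ⟨max D (K * B), by positivity,
    hup.mono (le_max_right _ _), hlow.mono (le_max_left _ _)⟩

end James

/-! ### Spreading models in reflexive spaces -/

section SpreadingModel

variable {X Y : Type*} [NormedAddCommGroup X] [NormedSpace ℝ X] [NormedAddCommGroup Y]
  [NormedSpace ℝ Y]

/-- Bounded sequences in a reflexive space have weak cluster points. -/
theorem exists_forall_tendsto_ultrafilter (hX : IsReflexive X) (x : ℕ → X) (C : ℝ)
    (hx : ∀ i, ‖x i‖ ≤ C) (U : Ultrafilter ℕ) :
    ∃ z : X, ∀ f : StrongDual ℝ X, Tendsto (fun l => f (x l)) U (𝓝 (f z)) := by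
  have hbd (f : StrongDual ℝ X) (l : ℕ) : |f (x l)| ≤ C * ‖f‖ := by
    rw [mul_comm]
    exact (f.le_opNorm _).trans (by gcongr; exact hx l)
  have hlim (f : StrongDual ℝ X) :
      ∃ r ∈ Set.Icc (-(C * ‖f‖)) (C * ‖f‖), Tendsto (fun l => f (x l)) U (𝓝 r) :=
    isCompact_Icc.ultrafilter_le_nhds (U.map fun l => f (x l)) <| by
      rw [Ultrafilter.coe_map, le_principal_iff]
      exact mem_map.2 (Filter.univ_mem' fun l => abs_le.1 (hbd f l))
  choose r hr hlim using hlim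
  let F : StrongDual ℝ (StrongDual ℝ X) := LinearMap.mkContinuous
    { toFun := r
      map_add' := fun f g => tendsto_nhds_unique (hlim (f + g)) ((hlim f).add (hlim g))
      map_smul' := fun c f => tendsto_nhds_unique (hlim (c • f)) ((hlim f).const_mul c) } C
    fun f => abs_le.2 (hr f)
  obtain ⟨z, hz⟩ := hX F
  refine ⟨z, fun f => ?_⟩
  rw [← NormedSpace.dual_def ℝ X z f, hz]
  exact hlim f

/-- A bounded basic sequence in a reflexive space is weakly null: a weak cluster point lies in the
closed span of the sequence, and its coordinates there vanish. -/
theorem IsBasicSequence.tendsto_hyperfilter {x : ℕ → X} (h : IsBasicSequence x)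
    (hX : IsReflexive X) (C : ℝ) (hx : ∀ i, ‖x i‖ ≤ C) (f : StrongDual ℝ X) :
    Tendsto (fun l => f (x l)) (hyperfilter ℕ) (𝓝 0) := by
  obtain ⟨z, hz⟩ := exists_forall_tendsto_ultrafilter hX x C hx (hyperfilter ℕ)
  obtain ⟨b, hb⟩ := h
  have hzW : z ∈ (Submodule.span ℝ (Set.range x)).topologicalClosure := by
    by_contra hzW
    obtain ⟨g, u, hgz, hg⟩ := geometric_hahn_banach_point_closed (Submodule.convex _)
      (Submodule.isClosed_topologicalClosure _) hzW
    refine hgz.not_ge (ge_of_tendsto' (hz g) fun l => (hg _ ?_).le)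
    rw [← hb l]
    exact (b l).2
  have hcoord (j : ℕ) : b.coord j ⟨z, hzW⟩ = 0 := by
    obtain ⟨g, hg, -⟩ := exists_extension_norm_eq _ (b.coord j)
    rw [← hg ⟨z, hzW⟩]
    refine tendsto_nhds_unique (hz g) (tendsto_const_nhds.congr' ?_)
    filter_upwards [Nat.hyperfilter_le_atTop (eventually_gt_atTop j)] with l hl
    rw [← hb l, hg, b.ortho]
    simp [ne_of_lt hl]
  have hz0 : (⟨z, hzW⟩ : (Submodule.span ℝ (Set.range x)).topologicalClosure) = 0 := by
    refine tendsto_nhds_unique (SchauderBasis.tendsto_proj b _) ?_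
    simp only [SchauderBasis.proj_apply, hcoord, zero_smul, Finset.sum_const_zero]
    exact tendsto_const_nhds
  have hz0' : z = 0 := congrArg Subtype.val hz0
  simpa [hz0'] using hz f

/-- A gliding hump: a weakly null sequence with `‖x l‖ → ρ > 0` has a subsequence asymptotic to
`ρ` times a normalized block basis. -/
theorem exists_isNormalizedBlockBasis_tendsto (e : SchauderBasis ℝ X) (x : ℕ → X) {ρ : ℝ}
    (hρ : 0 < ρ) (hnorm : Tendsto (fun l => ‖x l‖) atTop (𝓝 ρ))
    (hx : ∀ f : StrongDual ℝ X, Tendsto (fun l => f (x l)) (hyperfilter ℕ) (𝓝 0)) :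
    ∃ (n : ℕ → ℕ) (v : ℕ → X), StrictMono n ∧ IsNormalizedBlockBasis e v ∧
      Tendsto (fun k => ‖x (n k) - ρ • v k‖) atTop (𝓝 0) := by
  obtain ⟨p, v, hp, hv, hQ⟩ := exists_isNormalizedBlockBasis e
    (fun k p q v => ∃ l, p ≤ l ∧ l < q ∧ ‖x l - ρ • v‖ ≤ 1 / ((k : ℝ) + 1)) fun k p => by
      obtain ⟨η, hη, hηk, hηρ⟩ : ∃ η > 0, 5 * η ≤ 1 / ((k : ℝ) + 1) ∧ 4 * η ≤ ρ := by
        have : 0 < 1 / ((k : ℝ) + 1) := by positivity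
        refine ⟨min (1 / ((k : ℝ) + 1) / 5) (ρ / 4), by positivity, ?_, ?_⟩
        · linarith [min_le_left (1 / ((k : ℝ) + 1) / 5) (ρ / 4)]
        · linarith [min_le_right (1 / ((k : ℝ) + 1) / 5) (ρ / 4)]
      have hproj : Tendsto (fun l => SchauderBasis.proj e p (x l)) (hyperfilter ℕ) (𝓝 0) := by
        simp only [SchauderBasis.proj_apply]
        rw [← Finset.sum_const_zero (s := Finset.range p)]
        refine tendsto_finsetSum _ fun j _ => ?_
        simpa using (hx (e.coord j)).smul_const (e j)
      obtain ⟨l, ⟨hl1, hl2⟩, hpl⟩ := ((hproj.norm.eventually_lt_const (by simpa using hη)).and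
        (Nat.hyperfilter_le_atTop (Metric.tendsto_nhds.1 hnorm η hη)) |>.and
        (Nat.hyperfilter_le_atTop (eventually_ge_atTop p))).exists
      rw [Real.dist_eq, abs_lt] at hl2
      obtain ⟨q, hq, hlq⟩ := ((Metric.tendsto_nhds.1 (SchauderBasis.tendsto_proj e (x l)) η hη).and
        (eventually_gt_atTop l)).exists
      rw [dist_eq_norm] at hq
      set u := ∑ j ∈ Finset.Ico p q, e.coord j (x l) • e j with hu
      have hu' : u = SchauderBasis.proj e q (x l) - SchauderBasis.proj e p (x l) := by
        rw [SchauderBasis.proj_apply, SchauderBasis.proj_apply, hu,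
          Finset.sum_Ico_eq_sub _ (hpl.trans hlq.le)]
      have hxu : ‖x l - u‖ ≤ 2 * η := by
        have : x l - u = SchauderBasis.proj e p (x l) - (SchauderBasis.proj e q (x l) - x l) := by
          rw [hu']; abel
        rw [this]
        exact (norm_sub_le _ _).trans (by linarith)
      have hux := abs_le.1 ((abs_norm_sub_norm_le (x l) u).trans hxu)
      have hupos : 0 < ‖u‖ := by linarith
      have hsum : ∑ j ∈ Finset.Ico p q, (‖u‖⁻¹ * e.coord j (x l)) • e j = ‖u‖⁻¹ • u := by
        rw [hu, Finset.smul_sum]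
        simp only [smul_smul]
      refine ⟨q, hpl.trans_lt hlq, fun j => ‖u‖⁻¹ * e.coord j (x l), ?_, l, hpl, hlq, ?_⟩
      · rw [hsum]
        exact norm_smul_inv_norm (𝕜 := ℝ) (norm_pos_iff.1 hupos)
      · rw [hsum]
        have h1 : u - ρ • ‖u‖⁻¹ • u = ((‖u‖ - ρ) * ‖u‖⁻¹) • u := by
          rw [sub_mul, mul_inv_cancel₀ hupos.ne', sub_smul, one_smul, smul_smul]
        have h2 : ‖u - ρ • ‖u‖⁻¹ • u‖ = |‖u‖ - ρ| := by
          rw [h1, norm_smul, norm_mul, norm_inv, norm_norm, mul_assoc,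
            inv_mul_cancel₀ hupos.ne', mul_one, Real.norm_eq_abs]
        have h3 : |‖u‖ - ρ| ≤ 3 * η := abs_le.2 ⟨by linarith, by linarith⟩
        have h4 := norm_sub_le_norm_sub_add_norm_sub (x l) u (ρ • ‖u‖⁻¹ • u)
        linarith
  choose n hpn hnp hn using hQ
  refine ⟨n, v, strictMono_nat_of_lt_succ fun k => (hnp k).trans_le (hpn (k + 1)), hv, ?_⟩
  exact squeeze_zero (fun _ => norm_nonneg _) hn tendsto_one_div_add_atTop_nhds_zero_nat

theorem sum_fin_ite_smul (s : Finset ℕ) (a : ℕ → ℝ) (z : ℕ → X) :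
    ∑ i : Fin (s.sup id + 1), (if (i : ℕ) ∈ s then a i else 0) • z i = ∑ i ∈ s, a i • z i := by
  have hs : s ⊆ Finset.range (s.sup id + 1) := fun i hi =>
    Finset.mem_range.2 (Nat.lt_succ_of_le (Finset.le_sup (f := id) hi))
  rw [Fin.sum_univ_eq_sum_range fun i => (if i ∈ s then a i else 0) • z i,
    ← Finset.sum_subset hs fun i _ hi => by rw [if_neg hi, zero_smul]]
  exact Finset.sum_congr rfl fun i hi => by rw [if_pos hi]

/-- The norms of a spreading model are limits of norms along the shifts of any subsequence of the
generating sequence. -/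
theorem GeneratesSpreadingModel.tendsto_norm_sum {x : ℕ → X} {y : ℕ → Y}
    (h : GeneratesSpreadingModel x y) {t : ℕ → ℕ} (ht : StrictMono t) (s : Finset ℕ)
    (a : ℕ → ℝ) : Tendsto (fun L => ‖∑ i ∈ s, a i • x (t (L + i))‖) atTop
      (𝓝 ‖∑ i ∈ s, a i • y i‖) := by
  classical
  rw [Metric.tendsto_atTop]
  intro ε hε
  obtain ⟨N, hN⟩ := h.2.2 (s.sup id) (fun i => if (i : ℕ) ∈ s then a i else 0) ε hε
  refine ⟨N + 1, fun L hL => ?_⟩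
  have := hN (fun i => t (L + i)) (fun i j hij => ht (Nat.add_lt_add_left hij L))
    (Nat.lt_of_lt_of_le hL ((ht.id_le L).trans (by simp)))
  rw [sum_fin_ite_smul, sum_fin_ite_smul s a fun i => x (t (L + i))] at this
  exact this

/-- The generating sequence has a subsequence asymptotic to a multiple of a normalized block basis
`v`, some subsequence of `v` is equivalent to `e`, and `e` is uniformly equivalent to its shifts, so
the limit defining the spreading model is controlled by `e`. -/
theorem IsRosenthal.equivalent_spreadingModel [CompleteSpace X] {e : SchauderBasis ℝ X}
    (he : IsRosenthal e) (hX : IsReflexive X) {x : ℕ → X} {y : ℕ → Y}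
    (h : GeneratesSpreadingModel x y) : Equivalent y e := by
  obtain ⟨c, C, hc, -, hcC⟩ := h.1
  have hnorm : Tendsto (fun l => ‖x l‖) atTop (𝓝 ‖y 0‖) := by
    simpa using h.tendsto_norm_sum strictMono_id {0} fun _ => 1
  have hρ : 0 < ‖y 0‖ := hc.trans_le (ge_of_tendsto' hnorm fun l => (hcC l).1.le)
  obtain ⟨n, v, hn, hv, hnv⟩ := exists_isNormalizedBlockBasis_tendsto e x hρ hnorm
    fun f => h.2.1.tendsto_hyperfilter hX C (fun i => (hcC i).2.le) f
  obtain ⟨K, hK, hsub⟩ := he.exists_isSubsymmetric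
  obtain ⟨φ, hφ, M, hM, hve, hev⟩ := he.exists_dominated hv
  have hadd (L : ℕ) : StrictMono fun i => L + i := fun i j hij => Nat.add_lt_add_left hij L
  have hlim (s : Finset ℕ) (a : ℕ → ℝ) : Tendsto
      (fun L => ‖y 0‖ * ‖∑ i ∈ s, a i • v (φ (L + i))‖) atTop (𝓝 ‖∑ i ∈ s, a i • y i‖) := by
    have hdiff : Tendsto (fun L => ∑ i ∈ s, |a i| * ‖x (n (φ (L + i))) - ‖y 0‖ • v (φ (L + i))‖)
        atTop (𝓝 0) := by
      simpa using tendsto_finsetSum s fun i _ =>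
        (hnv.comp (hφ.tendsto_atTop.comp (tendsto_add_atTop_nat i))).const_mul |a i|
    have hzero : Tendsto (fun L => ‖y 0‖ * ‖∑ i ∈ s, a i • v (φ (L + i))‖ -
        ‖∑ i ∈ s, a i • x (n (φ (L + i)))‖) atTop (𝓝 0) := by
      refine squeeze_zero_norm (fun L => ?_) hdiff
      rw [← norm_norm (y 0), ← norm_smul, norm_norm, Real.norm_eq_abs, abs_sub_comm]
      refine (abs_norm_sub_norm_le _ _).trans ?_
      rw [Finset.smul_sum, ← Finset.sum_sub_distrib]
      refine norm_sum_le_of_le _ fun i _ => ?_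
      rw [smul_comm, ← smul_sub, norm_smul, Real.norm_eq_abs]
    simpa using hzero.add (h.tendsto_norm_sum (hn.comp hφ) s a)
  have hup : Dominated (‖y 0‖ * (M * K)) y e := fun s a => by
    refine le_of_tendsto' (hlim s a) fun L => ?_
    rw [mul_assoc]
    gcongr
    exact ((hve.comp (hadd L).injective).trans hM.le (hsub _ (hadd L)).1) s a
  have hlow : Dominated ((K * M) / ‖y 0‖) e y := fun s a => by
    rw [div_mul_eq_mul_div, le_div_iff₀' hρ]
    refine ge_of_tendsto' ((hlim s a).const_mul (K * M)) fun L => ?_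
    have := ((hsub _ (hadd L)).2.trans hK.le (hev.comp (hadd L).injective)) s a
    calc _ ≤ ‖y 0‖ * (K * M * ‖∑ i ∈ s, a i • v (φ (L + i))‖) := by gcongr; exact this
      _ = _ := by ring
  exact equivalent_iff_dominated.2 ⟨max (‖y 0‖ * (M * K)) (K * M / ‖y 0‖), by positivity,
    hup.mono (le_max_left _ _), hlow.mono (le_max_right _ _)⟩

end SpreadingModel

end RosenthalBasis

theorem lemma3 {X : Type*} [NormedAddCommGroup X] [NormedSpace ℝ X] [CompleteSpace X]
    (e : SchauderBasis ℝ X) (he : RosenthalBasis.IsRosenthal e) :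
    (RosenthalBasis.Equivalent e RosenthalBasis.c0UnitVector ∨
      RosenthalBasis.Equivalent e RosenthalBasis.l1UnitVector ∨
      RosenthalBasis.IsReflexive X) ∧
    (RosenthalBasis.IsReflexive X →
      ∀ (Y : Type*) [NormedAddCommGroup Y] [NormedSpace ℝ Y] (x : ℕ → X) (y : ℕ → Y),
        RosenthalBasis.GeneratesSpreadingModel x y → RosenthalBasis.Equivalent y e) := by
  refine ⟨?_, fun hX Y _ _ x y h => he.equivalent_spreadingModel hX h⟩
  by_cases hb : RosenthalBasis.IsBoundedlyComplete e
  · by_cases hs : RosenthalBasis.IsShrinking e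
    · exact .inr (.inr
        (RosenthalBasis.isReflexive_of_isShrinking_of_isBoundedlyComplete e hs hb))
    · exact .inr (.inl (he.equivalent_l1UnitVector hs))
  · exact .inl (he.equivalent_c0UnitVector hb)
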